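/- Fix an integer $b \ge 2$. Let $W$ be a non-negative random variable with $\mathbb{E}[W]=1$, and let $W(j_1,\dots,j_m)$, for $m \ge 1$ and $j_1,\dots,j_m \in \{0,\dots,b-1\}$, be independent copies of $W$. For $n \ge 0$ put \[ Y_n = b^{-n} \sum_{j_1,\dots,j_n \in \{0,\dots,b-1\}} W(j_1)\, W(j_1,j_2) \cdots W(j_1,\dots,j_n) \qquad (Y_0 = 1). \] Let $W_{TC}$ be the random variable with $\mathbb{P}(W_{TC}=0)=1-b^{-1}$ and $\mathbb{P}(W_{TC}=b)=b^{-1}$. Assume that $W$ is not equal in law to $W_{TC}$, and let $q>1$. Moments take values in $[0,+\infty]$, and $\log(+\infty)=+\infty$. (1) If $\mathbb{E}[W^q] < b^{q-1}$, then $\sup_n \mathbb{E}[Y_n^q] < \infty$. (2) If $\mathbb{E}[W^q] > b^{q-1}$ (the case $\mathbb{E}[W^q]=+\infty$ included), then \[ \liminf_{n\to\infty} \frac{\log \mathbb{E}[Y_n^q]}{n} \ge \log \frac{\mathbb{E}[W^q]}{b^{q-1}}, \] and if moreover $1<q\le 2$, then \[ \lim_{n\to\infty} \frac{\log \mathbb{E}[Y_n^q]}{n}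 = \log \frac{\mathbb{E}[W^q]}{b^{q-1}}. \] -/

import Mathlib

open MeasureTheory ProbabilityTheory Filter Topology
open scoped ENNReal

noncomputable section

/-- The non-root vertices of the rooted `b`-adic tree: the words `(j₁, …, j_{m+1})`, `m ≥ 0`,
with letters in `{0, …, b-1}`. -/
abbrev CascadeVertex (b : ℕ) : Type := Σ m : ℕ, (Fin (m + 1) → Fin b)

/-- For a word `j = (j₁, …, jₙ)` and `k : Fin n`, its prefix `(j₁, …, j_{k+1})`. -/
def cascadePrefix {b n : ℕ} (j : Fin n → Fin b) (k : Fin n) : CascadeVertex b :=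
  ⟨k, fun i => j (Fin.castLE k.isLt i)⟩

/-- The total mass of the Mandelbrot cascade at generation `n`:
`Yₙ = b⁻ⁿ ∑_{j₁,…,jₙ} W(j₁) W(j₁,j₂) ⋯ W(j₁,…,jₙ)`. -/
def cascadeMass {Ω : Type*} {b : ℕ} (W : CascadeVertex b → Ω → ℝ) (n : ℕ) (ω : Ω) : ℝ :=
  ((b : ℝ) ^ n)⁻¹ * ∑ j : Fin n → Fin b, ∏ k : Fin n, W (cascadePrefix j k) ω

/-- The moment `𝔼[X ^ q] ∈ [0, ∞]` of an (almost surely) non-negative random variable `X`. -/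
def extMoment {Ω : Type*} [MeasurableSpace Ω] (P : Measure Ω) (X : Ω → ℝ) (q : ℝ) : ℝ≥0∞ :=
  ∫⁻ ω, ENNReal.ofReal (X ω ^ q) ∂P

/-- The law of the totally critical variable: value `0` with probability `1 - b⁻¹`
and value `b` with probability `b⁻¹`. -/
def totallyCriticalLaw (b : ℕ) : Measure ℝ :=
  (1 - (b : ℝ≥0∞)⁻¹) • Measure.dirac (0 : ℝ) + (b : ℝ≥0∞)⁻¹ • Measure.dirac (b : ℝ)

end

/-! Write q = 1 + p and ρ = E[W^q] / b^p. Splitting the tree at its first generation gives Y_{n+1} =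
b⁻¹ ∑ W(i) Y_n⁽ⁱ⁾ with independent summands. Superadditivity of x^q then yields E[Y_n^q] ≥ ρ^n, the
lower bound in (2).

For upper bounds, `rpow_sum_le_diag_add_cross` compares the q-th power of the sum with its diagonal
terms, at the cost of cross terms x_i x_j^p, i ≠ j. By independence these involve only moments of
order p. If those are bounded, the q-th moments obey u_{n+1} ≤ aρ u_n + const
(`lintegral_extCascadeMass_succ_rpow_le`). When ρ < 1, some a > 1 keeps aρ < 1, and the moments of
order p are bounded by induction, lowering the exponent by one until it is at most 1, where the mean
suffices. When ρ > 1 and q ≤ 2, subadditivity of x^p permits a = 1, so u_n ≤ Kρ^n. -/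

/-! ### Power inequalities in [0, ∞]. -/

theorem rpow_one_add {p : ℝ} (hp : 0 ≤ p) (x : ℝ≥0∞) : x ^ (1 + p) = x * x ^ p := by
  rw [ENNReal.rpow_add_of_nonneg _ _ zero_le_one hp, ENNReal.rpow_one]

theorem sum_rpow_le_card_rpow_mul {ι : Type*} (s : Finset ι) (x : ι → ℝ≥0∞) {p : ℝ} (hp : 0 < p) :
    (∑ j ∈ s, x j) ^ p ≤ (s.card : ℝ≥0∞) ^ p * ∑ j ∈ s, x j ^ p := by
  have h : ∑ j ∈ s, x j ≤ s.card * (∑ j ∈ s, x j ^ p) ^ p⁻¹ := by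
    rw [← nsmul_eq_mul]
    refine Finset.sum_le_card_nsmul _ _ _ fun j hj => ?_
    rw [ENNReal.le_rpow_inv_iff hp]
    exact Finset.single_le_sum (f := fun j => x j ^ p) (fun _ _ => zero_le) hj
  calc (∑ j ∈ s, x j) ^ p ≤ (s.card * (∑ j ∈ s, x j ^ p) ^ p⁻¹) ^ p := by gcongr
    _ = _ := by rw [ENNReal.mul_rpow_of_nonneg _ _ hp.le, ENNReal.rpow_inv_rpow hp.ne']

theorem sum_rpow_le_rpow_sum {ι : Type*} (s : Finset ι) (x : ι → ℝ≥0∞) {p : ℝ} (hp : 0 ≤ p) :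
    ∑ i ∈ s, x i ^ (1 + p) ≤ (∑ i ∈ s, x i) ^ (1 + p) := by
  rw [rpow_one_add hp, Finset.sum_mul]
  refine Finset.sum_le_sum fun i hi => ?_
  rw [rpow_one_add hp]
  gcongr
  exact Finset.single_le_sum (f := x) (fun _ _ => zero_le) hi

/-- With S the sum, expand S^(1+p) = ∑ x_i S^p and split S in the i-th term as x_i plus the rest.
The factor x_i stays to the first power, so the cross terms factor under independence. -/
theorem rpow_sum_le_diag_add_cross {ι : Type*} [DecidableEq ι] (s : Finset ι) (x : ι → ℝ≥0∞)
    {p : ℝ} (hp : 0 < p) {a C : ℝ≥0∞}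
    (h : ∀ y r : ℝ≥0∞, (y + r) ^ p ≤ a * y ^ p + C * r ^ p) :
    (∑ i ∈ s, x i) ^ (1 + p) ≤ a * ∑ i ∈ s, x i ^ (1 + p)
      + C * (s.card : ℝ≥0∞) ^ p * ∑ i ∈ s, ∑ j ∈ s.erase i, x i * x j ^ p := by
  rw [rpow_one_add hp.le, Finset.sum_mul, Finset.mul_sum, Finset.mul_sum,
    ← Finset.sum_add_distrib]
  refine Finset.sum_le_sum fun i hi => ?_
  rw [← Finset.add_sum_erase s x hi, rpow_one_add hp.le]
  calc x i * (x i + ∑ j ∈ s.erase i, x j) ^ p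
      ≤ x i * (a * x i ^ p + C * (∑ j ∈ s.erase i, x j) ^ p) := by gcongr; exact h _ _
    _ ≤ x i * (a * x i ^ p + C * ((s.card : ℝ≥0∞) ^ p * ∑ j ∈ s.erase i, x j ^ p)) := by
        gcongr
        refine (sum_rpow_le_card_rpow_mul _ _ hp).trans ?_
        gcongr
        exact Finset.erase_subset _ _
    _ = _ := by rw [← Finset.mul_sum]; ring

/-- Either r is a small multiple d of y and is absorbed by the margin a > 1, or y ≤ d⁻¹ r and the
second term alone suffices. -/
theorem exists_add_rpow_le {p : ℝ} (hp : 0 < p) {a : ℝ≥0∞} (ha : 1 < a) :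
    ∃ C : ℝ≥0∞, C ≠ ∞ ∧ ∀ y r : ℝ≥0∞, (y + r) ^ p ≤ a * y ^ p + C * r ^ p := by
  obtain ⟨t, ht1, hta⟩ : ∃ t : ℝ≥0∞, 1 < t ∧ t ^ p ≤ a := by
    refine ⟨a ^ p⁻¹, ENNReal.one_lt_rpow ha (inv_pos.2 hp), ?_⟩
    rw [ENNReal.rpow_inv_rpow hp.ne']
  obtain ⟨d, hd0, hdt⟩ : ∃ d : ℝ≥0∞, (0 < d ∧ d ≠ ∞) ∧ 1 + d ≤ t :=
    -- The minimum with 1 keeps d finite when a = ∞.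
    ⟨min (t - 1) 1, ⟨lt_min (tsub_pos_of_lt ht1) one_pos, by simp⟩,
      (add_le_add_right (min_le_left _ _) 1).trans (add_tsub_cancel_of_le ht1.le).le⟩
  refine ⟨(d⁻¹ + 1) ^ p, ENNReal.rpow_ne_top_of_nonneg hp.le (by simp [hd0.1.ne']), fun y r => ?_⟩
  rcases le_total r (d * y) with hr | hr
  · refine le_trans ?_ le_self_add
    calc (y + r) ^ p ≤ (t * y) ^ p := by
          gcongr
          calc y + r ≤ y + d * y := by gcongr
            _ = (1 + d) * y := by ring
            _ ≤ t * y := by gcongr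
      _ = t ^ p * y ^ p := ENNReal.mul_rpow_of_nonneg _ _ hp.le
      _ ≤ a * y ^ p := by gcongr
  · refine le_trans ?_ le_add_self
    rw [← ENNReal.mul_rpow_of_nonneg _ _ hp.le]
    gcongr
    rw [add_mul, one_mul]
    gcongr
    exact (ENNReal.mul_le_iff_le_inv hd0.1.ne' hd0.2).1 hr

/-! ### Affine recursions. -/

theorem geometric_affine_bound {u : ℕ → ℝ≥0∞} {r C : ℝ≥0∞} (h0 : u 0 ≤ 1)
    (h : ∀ n, u (n + 1) ≤ r * u n + C) (hr : r < 1) (n : ℕ) :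
    u n ≤ 1 + C * (1 - r)⁻¹ := by
  have key : u n ≤ 1 + C * ∑ k ∈ Finset.range n, r ^ k := by
    induction n with
    | zero => simpa using h0
    | succ n ih =>
      calc u (n + 1) ≤ r * (1 + C * ∑ k ∈ Finset.range n, r ^ k) + C := (h n).trans (by gcongr)
        _ = r + C * ∑ k ∈ Finset.range (n + 1), r ^ k := by
          rw [geom_sum_succ]; ring
        _ ≤ _ := by gcongr
  refine key.trans ?_
  rw [← ENNReal.tsum_geometric]
  gcongr
  exact ENNReal.sum_le_tsum _

theorem geometric_affine_growth {u : ℕ → ℝ≥0∞} {r C : ℝ≥0∞} (h0 : u 0 ≤ 1)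
    (h : ∀ n, u (n + 1) ≤ r * u n + C) (hr : 1 < r) (hr' : r ≠ ∞) (n : ℕ) :
    u n ≤ (1 + C / (r - 1)) * r ^ n := by
  set D := C / (r - 1)
  -- Shifting by D turns the affine recursion into a purely geometric one.
  have hD : C + D = r * D := by
    have : (r - 1) * D = C := ENNReal.mul_div_cancel (tsub_pos_of_lt hr).ne' (by finiteness)
    nth_rewrite 1 [← this]
    rw [← add_one_mul, tsub_add_cancel_of_le hr.le]
  suffices u n + D ≤ (1 + D) * r ^ n from le_self_add.trans this
  induction n with
  | zero => simpa using add_le_add_left h0 D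
  | succ n ih =>
    calc u (n + 1) + D ≤ r * u n + C + D := by gcongr; exact h n
      _ = r * (u n + D) := by rw [add_assoc, hD]; ring
      _ ≤ r * ((1 + D) * r ^ n) := by gcongr
      _ = _ := by ring

/-! ### Decomposition of the tree at its first generation. -/

/-- The vertices of the subtree rooted at the first-generation vertex `i`, as words `i v`. -/
def CascadeVertex.cons {b : ℕ} (i : Fin b) (v : CascadeVertex b) : CascadeVertex b :=
  ⟨v.1 + 1, Fin.cons i v.2⟩

/-- The first-generation vertex `i`. -/
def CascadeVertex.root {b : ℕ} (i : Fin b) : CascadeVertex b := ⟨0, fun _ => i⟩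

theorem CascadeVertex.cons_injective {b : ℕ} (i : Fin b) :
    Function.Injective (CascadeVertex.cons i) := by
  rintro ⟨m, v⟩ ⟨m', v'⟩ h
  simp only [CascadeVertex.cons, Sigma.mk.injEq, Nat.add_right_cancel_iff] at h
  obtain ⟨rfl, h⟩ := h
  have hv : v = v' := Fin.cons_right_injective (α := fun _ => Fin b) i (eq_of_heq h)
  rw [hv]

theorem cascadePrefix_cons_zero {b n : ℕ} (i : Fin b) (j : Fin n → Fin b) :
    cascadePrefix (Fin.cons i j : Fin (n + 1) → Fin b) 0 = CascadeVertex.root i := by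
  simp only [cascadePrefix, CascadeVertex.root]
  congr 1
  funext k
  obtain rfl : k = 0 := Fin.fin_one_eq_zero k
  rfl

theorem cascadePrefix_cons_succ {b n : ℕ} (i : Fin b) (j : Fin n → Fin b) (k : Fin n) :
    cascadePrefix (Fin.cons i j : Fin (n + 1) → Fin b) k.succ =
      CascadeVertex.cons i (cascadePrefix j k) := by
  simp only [cascadePrefix, CascadeVertex.cons]
  congr 1
  funext l
  refine Fin.cases ?_ (fun l => ?_) l <;> rfl

section

variable {Ω : Type*} {b : ℕ}

/-- The total mass at generation `n` of a cascade with weights in `[0, ∞]`. -/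
noncomputable def extCascadeMass (V : CascadeVertex b → Ω → ℝ≥0∞) (n : ℕ) (ω : Ω) : ℝ≥0∞ :=
  ((b : ℝ≥0∞) ^ n)⁻¹ * ∑ j : Fin n → Fin b, ∏ k : Fin n, V (cascadePrefix j k) ω

theorem extCascadeMass_zero (V : CascadeVertex b → Ω → ℝ≥0∞) (ω : Ω) :
    extCascadeMass V 0 ω = 1 := by
  simp [extCascadeMass]

/-- The contribution of the subtree rooted at `i` to `b` times the mass at generation `n + 1`. -/
noncomputable def branchMass (V : CascadeVertex b → Ω → ℝ≥0∞) (n : ℕ) (i : Fin b) (ω : Ω) : ℝ≥0∞ :=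
  V (CascadeVertex.root i) ω * extCascadeMass (fun v => V (CascadeVertex.cons i v)) n ω

theorem extCascadeMass_succ (V : CascadeVertex b → Ω → ℝ≥0∞) (n : ℕ) (ω : Ω) :
    extCascadeMass V (n + 1) ω = (b : ℝ≥0∞)⁻¹ * ∑ i, branchMass V n i ω := by
  have hinv : ((b : ℝ≥0∞) ^ (n + 1))⁻¹ = (b : ℝ≥0∞)⁻¹ * ((b : ℝ≥0∞) ^ n)⁻¹ := by
    rw [pow_succ', ENNReal.mul_inv (by simp) (by simp)]
  rw [extCascadeMass, hinv, mul_assoc,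
    ← (Fin.consEquiv fun _ : Fin (n + 1) => Fin b).sum_comp, Fintype.sum_prod_type, Finset.mul_sum]
  congr 1
  refine Finset.sum_congr rfl fun i _ => ?_
  have hprod (j : Fin n → Fin b) :
      ∏ k, V (cascadePrefix (Fin.consEquiv (fun _ : Fin (n + 1) => Fin b) (i, j)) k) ω =
        V (CascadeVertex.root i) ω * ∏ k, V (CascadeVertex.cons i (cascadePrefix j k)) ω := by
    change ∏ k, V (cascadePrefix (Fin.cons i j : Fin (n + 1) → Fin b) k) ω = _
    rw [Fin.prod_univ_succ, cascadePrefix_cons_zero]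
    simp only [cascadePrefix_cons_succ]
  simp only [hprod, branchMass, extCascadeMass]
  rw [← Finset.mul_sum]
  ring

/-! ### Independence of branches and moment recursions. -/

/-- The σ-algebra generated by the weights at the vertices in `S`. -/
@[reducible] def weightSigma (V : CascadeVertex b → Ω → ℝ≥0∞) (S : Set (CascadeVertex b)) :
    MeasurableSpace Ω :=
  ⨆ v ∈ S, MeasurableSpace.comap (V v) inferInstance

theorem measurable_weightSigma (V : CascadeVertex b → Ω → ℝ≥0∞) {S : Set (CascadeVertex b)}
    {v : CascadeVertex b} (hv : v ∈ S) : Measurable[weightSigma V S] (V v) :=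
  measurable_iff_comap_le.2
    (le_iSup₂ (f := fun v (_ : v ∈ S) => MeasurableSpace.comap (V v) inferInstance) v hv)

theorem measurable_extCascadeMass {m : MeasurableSpace Ω} {V : CascadeVertex b → Ω → ℝ≥0∞}
    (hV : ∀ v, Measurable (V v)) (n : ℕ) : Measurable (extCascadeMass V n) :=
  (Finset.measurable_sum _ fun _ _ => Finset.measurable_prod _ fun _ _ => hV _).const_mul _

theorem measurable_branchMass {m : MeasurableSpace Ω} {V : CascadeVertex b → Ω → ℝ≥0∞}
    (n : ℕ) {i : Fin b} (h₀ : Measurable (V (CascadeVertex.root i)))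
    (h : ∀ v, Measurable (V (CascadeVertex.cons i v))) : Measurable (branchMass V n i) :=
  h₀.mul (measurable_extCascadeMass h n)

theorem measurable_branchMass_weightSigma (V : CascadeVertex b → Ω → ℝ≥0∞) (n : ℕ) (i : Fin b) :
    Measurable[weightSigma V {v | v.2 0 = i}] (branchMass V n i) := by
  have h₀ : CascadeVertex.root i ∈ {v : CascadeVertex b | v.2 0 = i} := rfl
  have h (v) : CascadeVertex.cons i v ∈ {v : CascadeVertex b | v.2 0 = i} := rfl
  exact measurable_branchMass n (measurable_weightSigma V h₀)
    fun v => measurable_weightSigma V (h v)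

variable [MeasurableSpace Ω]

/-- The weights are independent with common law `μ`. -/
structure IsCascade (P : Measure Ω) (μ : Measure ℝ≥0∞) (V : CascadeVertex b → Ω → ℝ≥0∞) :
    Prop where
  measurable : ∀ v, Measurable (V v)
  indep : iIndepFun V P
  map_eq : ∀ v, P.map (V v) = μ

namespace IsCascade

variable {P : Measure Ω} {μ : Measure ℝ≥0∞} {V : CascadeVertex b → Ω → ℝ≥0∞}

theorem subtree (h : IsCascade P μ V) (i : Fin b) :
    IsCascade P μ fun v => V (CascadeVertex.cons i v) where
  measurable _ := h.measurable _
  indep := h.indep.precomp (CascadeVertex.cons_injective i)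
  map_eq _ := h.map_eq _

theorem lintegral_rpow (h : IsCascade P μ V) (v : CascadeVertex b) (s : ℝ) :
    ∫⁻ ω, V v ω ^ s ∂P = ∫⁻ x, x ^ s ∂μ := by
  rw [← h.map_eq v, lintegral_map (by fun_prop) (h.measurable v)]

theorem lintegral_mul_of_disjoint (h : IsCascade P μ V) {S T : Set (CascadeVertex b)}
    (hST : Disjoint S T) {f g : Ω → ℝ≥0∞} (hf : Measurable[weightSigma V S] f)
    (hg : Measurable[weightSigma V T] g) :
    ∫⁻ ω, f ω * g ω ∂P = (∫⁻ ω, f ω ∂P) * ∫⁻ ω, g ω ∂P :=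
  lintegral_mul_eq_lintegral_mul_lintegral_of_independent_measurableSpace
    (iSup₂_le fun v _ => (h.measurable v).comap_le) (iSup₂_le fun v _ => (h.measurable v).comap_le)
    (indep_iSup_of_disjoint (fun v => (h.measurable v).comap_le) h.indep hST) hf hg

theorem measurable_branchMass (h : IsCascade P μ V) (n : ℕ) (i : Fin b) :
    Measurable (branchMass V n i) :=
  _root_.measurable_branchMass n (h.measurable _) fun _ => h.measurable _

theorem lintegral_branchMass_rpow (h : IsCascade P μ V) (n : ℕ) (i : Fin b) {s : ℝ} (hs : 0 ≤ s) :
    ∫⁻ ω, branchMass V n i ω ^ s ∂P = (∫⁻ x, x ^ s ∂μ) *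
      ∫⁻ ω, extCascadeMass (fun v => V (CascadeVertex.cons i v)) n ω ^ s ∂P := by
  simp only [branchMass, ENNReal.mul_rpow_of_nonneg _ _ hs]
  rw [h.lintegral_mul_of_disjoint (S := {CascadeVertex.root i})
    (T := Set.range (CascadeVertex.cons i)), h.lintegral_rpow]
  · rw [Set.disjoint_singleton_left]
    rintro ⟨v, hv⟩
    exact Nat.succ_ne_zero _ (congrArg Sigma.fst hv)
  · exact Measurable.pow_const (measurable_weightSigma V (Set.mem_singleton _)) s
  · exact Measurable.pow_const (measurable_extCascadeMass
      (fun v => measurable_weightSigma V (Set.mem_range_self v)) n) s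

theorem lintegral_branchMass_mul_rpow (h : IsCascade P μ V) (n : ℕ) {i j : Fin b} (hij : i ≠ j)
    (s : ℝ) :
    ∫⁻ ω, branchMass V n i ω * branchMass V n j ω ^ s ∂P =
      (∫⁻ ω, branchMass V n i ω ∂P) * ∫⁻ ω, branchMass V n j ω ^ s ∂P := by
  refine h.lintegral_mul_of_disjoint (S := {v | v.2 0 = i}) (T := {v | v.2 0 = j})
    (Set.disjoint_left.2 fun v hi hj => hij (hi.symm.trans hj))
    (measurable_branchMass_weightSigma V n i)
    (Measurable.pow_const (measurable_branchMass_weightSigma V n j) s)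

theorem lintegral_extCascadeMass [IsProbabilityMeasure P] (hb : b ≠ 0) (hμ : ∫⁻ x, x ∂μ = 1)
    (h : IsCascade P μ V) (n : ℕ) : ∫⁻ ω, extCascadeMass V n ω ∂P = 1 := by
  induction n generalizing V with
  | zero => simp [extCascadeMass_zero]
  | succ n ih =>
    have hbr (i : Fin b) : ∫⁻ ω, branchMass V n i ω ∂P = 1 := by
      simpa [hμ, ih (h.subtree i)] using h.lintegral_branchMass_rpow n i zero_le_one
    simp only [extCascadeMass_succ]
    rw [lintegral_const_mul _ (Finset.measurable_sum _ fun i _ => h.measurable_branchMass n i),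
      lintegral_finsetSum _ fun i _ => h.measurable_branchMass n i]
    simp [hbr, ENNReal.inv_mul_cancel, hb]

/-- Only the diagonal terms are kept: b branches, each scaled by b^(-(1+p)), contribute one factor
E[W^(1+p)] / b^p per generation. Infinite moments are allowed. -/
theorem pow_le_lintegral_extCascadeMass_rpow [IsProbabilityMeasure P] (hb : b ≠ 0)
    (h : IsCascade P μ V) {p : ℝ} (hp : 0 ≤ p) (n : ℕ) :
    ((∫⁻ x, x ^ (1 + p) ∂μ) / (b : ℝ≥0∞) ^ p) ^ n ≤
      ∫⁻ ω, extCascadeMass V n ω ^ (1 + p) ∂P := by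
  induction n generalizing V with
  | zero => simp [extCascadeMass_zero]
  | succ n ih =>
    set m := ∫⁻ x, x ^ (1 + p) ∂μ
    have hp' : 0 ≤ 1 + p := by linarith
    have hbr (i : Fin b) : m * (m / (b : ℝ≥0∞) ^ p) ^ n ≤ ∫⁻ ω, branchMass V n i ω ^ (1 + p) ∂P := by
      rw [h.lintegral_branchMass_rpow n i hp']
      gcongr
      exact ih (h.subtree i)
    have hb1 : (b : ℝ≥0∞)⁻¹ * b = 1 := ENNReal.inv_mul_cancel (by simpa) (by simp)
    calc (m / (b : ℝ≥0∞) ^ p) ^ (n + 1)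
        = (b : ℝ≥0∞)⁻¹ ^ (1 + p) * ∑ _i : Fin b, m * (m / (b : ℝ≥0∞) ^ p) ^ n := by
          rw [Finset.sum_const, Finset.card_univ, Fintype.card_fin, nsmul_eq_mul, rpow_one_add hp,
            pow_succ', ENNReal.inv_rpow]
          calc _ = ((b : ℝ≥0∞)⁻¹ * b) * (m * ((b : ℝ≥0∞) ^ p)⁻¹ * (m / (b : ℝ≥0∞) ^ p) ^ n) := by
                rw [hb1, one_mul, div_eq_mul_inv m]
            _ = _ := by ring
      _ ≤ (b : ℝ≥0∞)⁻¹ ^ (1 + p) * ∑ i : Fin b, ∫⁻ ω, branchMass V n i ω ^ (1 + p) ∂P := by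
          gcongr with i; exact hbr i
      _ = ∫⁻ ω, (b : ℝ≥0∞)⁻¹ ^ (1 + p) * ∑ i : Fin b, branchMass V n i ω ^ (1 + p) ∂P := by
          rw [lintegral_const_mul _ (Finset.measurable_sum _ fun i _ =>
              (h.measurable_branchMass n i).pow_const _),
            lintegral_finsetSum _ fun i _ => (h.measurable_branchMass n i).pow_const _]
      _ ≤ _ := by
          refine lintegral_mono fun ω => ?_
          rw [extCascadeMass_succ, ENNReal.mul_rpow_of_nonneg _ _ hp']
          gcongr
          exact sum_rpow_le_rpow_sum _ _ hp

/-- If the moments of order `p` of all cascades are bounded by `K`, those of order `1 + p` obey an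
affine recursion. -/
theorem lintegral_extCascadeMass_succ_rpow_le [IsProbabilityMeasure P] (hb : b ≠ 0)
    (hμ : ∫⁻ x, x ∂μ = 1) (h : IsCascade P μ V) {p : ℝ} (hp : 0 < p) {a C K M : ℝ≥0∞}
    (hC : ∀ y r : ℝ≥0∞, (y + r) ^ p ≤ a * y ^ p + C * r ^ p) (n : ℕ)
    (hK : ∀ i, ∫⁻ ω, extCascadeMass (fun v => V (CascadeVertex.cons i v)) n ω ^ p ∂P ≤ K)
    (hM : ∀ i, ∫⁻ ω, extCascadeMass (fun v => V (CascadeVertex.cons i v)) n ω ^ (1 + p) ∂P ≤ M) :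
    ∫⁻ ω, extCascadeMass V (n + 1) ω ^ (1 + p) ∂P ≤
      a * ((∫⁻ x, x ^ (1 + p) ∂μ) / (b : ℝ≥0∞) ^ p) * M +
        C * (b : ℝ≥0∞) ^ p * (b * (b * ((∫⁻ x, x ^ p ∂μ) * K))) := by
  set m := ∫⁻ x, x ^ (1 + p) ∂μ
  set m' := ∫⁻ x, x ^ p ∂μ
  have hp' : 0 ≤ 1 + p := by linarith
  have hb1 : (b : ℝ≥0∞)⁻¹ * b = 1 := ENNReal.inv_mul_cancel (by simpa) (by simp)
  have hmeas i : Measurable (branchMass V n i) := h.measurable_branchMass n i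
  have hone (i : Fin b) : ∫⁻ ω, branchMass V n i ω ∂P = 1 := by
    simpa [hμ, lintegral_extCascadeMass hb hμ (h.subtree i)] using
      h.lintegral_branchMass_rpow n i zero_le_one
  have hdiag : ∑ i : Fin b, ∫⁻ ω, branchMass V n i ω ^ (1 + p) ∂P ≤ b * (m * M) := by
    refine (Finset.sum_le_card_nsmul _ _ (m * M) fun i _ => ?_).trans (by simp)
    rw [h.lintegral_branchMass_rpow n i hp']
    gcongr
    exact hM i
  have hcross : ∑ i : Fin b, ∑ j ∈ Finset.univ.erase i,
      ∫⁻ ω, branchMass V n i ω * branchMass V n j ω ^ p ∂P ≤ b * (b * (m' * K)) := by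
    refine (Finset.sum_le_card_nsmul _ _ (b * (m' * K)) fun i _ => ?_).trans (by simp)
    refine (Finset.sum_le_card_nsmul _ _ (m' * K) fun j hj => ?_).trans ?_
    · rw [h.lintegral_branchMass_mul_rpow n (Finset.ne_of_mem_erase hj).symm, hone, one_mul,
        h.lintegral_branchMass_rpow n j hp.le]
      gcongr
      exact hK j
    · rw [nsmul_eq_mul]
      gcongr
      simp
  have hinv : (b : ℝ≥0∞)⁻¹ ^ (1 + p) ≤ 1 :=
    ENNReal.rpow_le_one (ENNReal.inv_le_one.2 (by exact_mod_cast Nat.one_le_iff_ne_zero.2 hb)) hp'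
  calc ∫⁻ ω, extCascadeMass V (n + 1) ω ^ (1 + p) ∂P
      ≤ ∫⁻ ω, (b : ℝ≥0∞)⁻¹ ^ (1 + p) * (a * ∑ i, branchMass V n i ω ^ (1 + p) +
          C * (b : ℝ≥0∞) ^ p * ∑ i, ∑ j ∈ Finset.univ.erase i,
            branchMass V n i ω * branchMass V n j ω ^ p) ∂P := by
        refine lintegral_mono fun ω => ?_
        rw [extCascadeMass_succ, ENNReal.mul_rpow_of_nonneg _ _ hp']
        gcongr
        simpa using rpow_sum_le_diag_add_cross Finset.univ (fun i => branchMass V n i ω) hp hC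
    _ = (b : ℝ≥0∞)⁻¹ ^ (1 + p) * (a * ∑ i, ∫⁻ ω, branchMass V n i ω ^ (1 + p) ∂P +
          C * (b : ℝ≥0∞) ^ p * ∑ i, ∑ j ∈ Finset.univ.erase i,
            ∫⁻ ω, branchMass V n i ω * branchMass V n j ω ^ p ∂P) := by
        rw [lintegral_const_mul _ (by fun_prop), lintegral_add_left (by fun_prop),
          lintegral_const_mul _ (by fun_prop), lintegral_const_mul _ (by fun_prop),
          lintegral_finsetSum _ (by fun_prop), lintegral_finsetSum _ (by fun_prop)]
        congr! 4 with i
        rw [lintegral_finsetSum _ (by fun_prop)]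
    _ ≤ (b : ℝ≥0∞)⁻¹ ^ (1 + p) * (a * (b * (m * M)) +
          C * (b : ℝ≥0∞) ^ p * (b * (b * (m' * K)))) := by gcongr
    -- The prefactor is essential on the diagonal, where it produces the ratio, but is discarded on
    -- the cross terms, which only need a finite bound.
    _ ≤ (b : ℝ≥0∞)⁻¹ ^ (1 + p) * (a * (b * (m * M))) +
          1 * (C * (b : ℝ≥0∞) ^ p * (b * (b * (m' * K)))) := by
        rw [mul_add]; gcongr
    _ = _ := by
        rw [one_mul, rpow_one_add hp.le, ENNReal.inv_rpow, div_eq_mul_inv]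
        congr 1
        calc _ = ((b : ℝ≥0∞)⁻¹ * b) * (a * (m * ((b : ℝ≥0∞) ^ p)⁻¹) * M) := by ring
          _ = _ := by rw [hb1, one_mul]

end IsCascade

end

/-! ### Comparison of moments of different orders. -/

theorem rpow_le_one_add_rpow {s t : ℝ} (hs : 0 ≤ s) (hst : s ≤ t) (x : ℝ≥0∞) :
    x ^ s ≤ 1 + x ^ t := by
  rcases le_total x 1 with hx | hx
  · exact (ENNReal.rpow_le_one hx hs).trans le_self_add
  · exact (ENNReal.rpow_le_rpow_of_exponent_le hx hst).trans le_add_self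

theorem lintegral_rpow_le_one_add {α : Type*} [MeasurableSpace α] (μ : Measure α)
    [IsProbabilityMeasure μ] (f : α → ℝ≥0∞) {s t : ℝ} (hs : 0 ≤ s) (hst : s ≤ t) :
    ∫⁻ x, f x ^ s ∂μ ≤ 1 + ∫⁻ x, f x ^ t ∂μ := by
  calc ∫⁻ x, f x ^ s ∂μ ≤ ∫⁻ x, (1 + f x ^ t) ∂μ :=
        lintegral_mono fun x => rpow_le_one_add_rpow hs hst _
    _ = _ := by rw [lintegral_add_left measurable_const]; simp

/-- The condition `𝔼[X ^ (1 + p)] < b ^ p` for a variable of mean one passes to smaller `p`. -/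
theorem lintegral_rpow_lt_of_lt {μ : Measure ℝ≥0∞} (hμ : ∫⁻ x, x ∂μ = 1) {b : ℝ≥0∞}
    {p r : ℝ} (hr : 0 < r) (hrp : r ≤ p) (h : ∫⁻ x, x ^ (1 + p) ∂μ < b ^ p) :
    ∫⁻ x, x ^ (1 + r) ∂μ < b ^ r := by
  have hp : 0 < p := hr.trans_le hrp
  have hθ : 0 < r / p := div_pos hr hp
  have hθ1 : r / p ≤ 1 := (div_le_one hp).2 hrp
  -- Hölder between the orders 1 and 1 + p with weight θ = r / p; mean one removes the first factor.
  calc ∫⁻ x, x ^ (1 + r) ∂μ = ∫⁻ x, x ^ (1 - r / p) * (x ^ (1 + p)) ^ (r / p) ∂μ := by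
        refine lintegral_congr fun x => ?_
        rw [← ENNReal.rpow_mul, ← ENNReal.rpow_add_of_nonneg _ _ (by linarith) (by positivity)]
        congr 1
        field_simp
        ring
    _ ≤ (∫⁻ x, x ∂μ) ^ (1 - r / p) * (∫⁻ x, x ^ (1 + p) ∂μ) ^ (r / p) :=
        ENNReal.lintegral_mul_norm_pow_le (by fun_prop) (by fun_prop) (by linarith) hθ.le (by ring)
    _ = (∫⁻ x, x ^ (1 + p) ∂μ) ^ (r / p) := by rw [hμ, ENNReal.one_rpow, one_mul]
    _ < (b ^ p) ^ (r / p) := ENNReal.rpow_lt_rpow h hθ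
    _ = b ^ r := by rw [← ENNReal.rpow_mul, mul_div_cancel₀ _ hp.ne']

/-! ### Exponential growth rates. -/

theorem log_pow_div_natCast (x : ℝ≥0∞) {n : ℕ} (hn : n ≠ 0) :
    ENNReal.log (x ^ n) / (n : EReal) = ENNReal.log x := by
  rw [ENNReal.log_pow, mul_comm, ← EReal.mul_div, EReal.div_self, mul_one]
  · exact EReal.natCast_ne_bot n
  · exact EReal.natCast_ne_top n
  · exact_mod_cast hn

theorem eventually_log_le_log_div {u : ℕ → ℝ≥0∞} {r : ℝ≥0∞} (h : ∀ n, r ^ n ≤ u n) :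
    ∀ᶠ n : ℕ in atTop, ENNReal.log r ≤ ENNReal.log (u n) / (n : EReal) := by
  filter_upwards [eventually_ne_atTop 0] with n hn
  rw [← log_pow_div_natCast r hn]
  exact EReal.div_le_div_right_of_nonneg (by positivity) (ENNReal.log_le_log (h n))

theorem tendsto_log_div {u : ℕ → ℝ≥0∞} {r K : ℝ≥0∞} (hK : K ≠ 0) (hK' : K ≠ ∞)
    (h : ∀ n, r ^ n ≤ u n) (h' : ∀ n, u n ≤ K * r ^ n) :
    Tendsto (fun n : ℕ => ENNReal.log (u n) / (n : EReal)) atTop (𝓝 (ENNReal.log r)) := by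
  have hlim : Tendsto (fun n : ℕ => ENNReal.log K / (n : EReal) + ENNReal.log r) atTop
      (𝓝 (ENNReal.log r)) := by
    have h0 := EReal.tendsto_const_div_atTop_nhds_zero_nat (C := ENNReal.log K)
      (by simpa using hK) (by simpa using hK')
    have := (EReal.continuousAt_add (p := (0, ENNReal.log r)) (by simp) (by simp)).tendsto.comp
      (h0.prodMk_nhds tendsto_const_nhds)
    rw [zero_add] at this
    exact this
  refine tendsto_of_tendsto_of_tendsto_of_le_of_le' tendsto_const_nhds hlim
    (eventually_log_le_log_div h) ?_
  filter_upwards [eventually_ne_atTop 0] with n hn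
  rw [← log_pow_div_natCast r hn, ← EReal.add_div_of_nonneg_right (by positivity),
    ← ENNReal.log_mul_add]
  exact EReal.div_le_div_right_of_nonneg (by positivity) (ENNReal.log_le_log (h' n))

/-! ### Passage from real to extended non-negative weights. -/

theorem ofReal_cascadeMass {α : Type*} {b : ℕ} (hb : b ≠ 0)
    {W : CascadeVertex b → α → ℝ} {ω : α} (h : ∀ v, 0 ≤ W v ω) (n : ℕ) :
    ENNReal.ofReal (cascadeMass W n ω) =
      extCascadeMass (fun v ω => ENNReal.ofReal (W v ω)) n ω := by
  rw [cascadeMass, extCascadeMass, ENNReal.ofReal_mul (by positivity),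
    ENNReal.ofReal_sum_of_nonneg fun j _ => Finset.prod_nonneg fun k _ => h _]
  congr 1
  · rw [ENNReal.ofReal_inv_of_pos (by positivity), ENNReal.ofReal_pow (by positivity),
      ENNReal.ofReal_natCast]
  · exact Finset.sum_congr rfl fun j _ => ENNReal.ofReal_prod_of_nonneg fun k _ => h _

theorem extMoment_eq_lintegral {α : Type*} [MeasurableSpace α] {ν : Measure α} {X : α → ℝ} (hX : ∀ᵐ ω ∂ν, 0 ≤ X ω) {q : ℝ} (hq : 0 ≤ q) :
    extMoment ν X q = ∫⁻ ω, ENNReal.ofReal (X ω) ^ q ∂ν :=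
  lintegral_congr_ae (hX.mono fun _ h => (ENNReal.ofReal_rpow_of_nonneg h hq).symm)

section

variable {Ω : Type*} [MeasurableSpace Ω] {b : ℕ}

/-- The largest moment of order `s` at generation `n` of the cascades on `Ω` with weights of
law `μ`. -/
noncomputable def supMoment (b : ℕ) (P : Measure Ω) (μ : Measure ℝ≥0∞) (s : ℝ) (n : ℕ) : ℝ≥0∞ :=
  ⨆ (V : CascadeVertex b → Ω → ℝ≥0∞) (_ : IsCascade P μ V), ∫⁻ ω, extCascadeMass V n ω ^ s ∂P

variable {P : Measure Ω} {μ : Measure ℝ≥0∞}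

theorem IsCascade.lintegral_rpow_le_supMoment {V : CascadeVertex b → Ω → ℝ≥0∞}
    (h : IsCascade P μ V) (s : ℝ) (n : ℕ) :
    ∫⁻ ω, extCascadeMass V n ω ^ s ∂P ≤ supMoment b P μ s n :=
  le_iSup₂ (f := fun V (_ : IsCascade P μ V) => ∫⁻ ω, extCascadeMass V n ω ^ s ∂P) V h

/-- Almost surely, a cascade with real weights agrees with a cascade in the extended sense. -/
theorem exists_isCascade {Ω₀ : Type*} [MeasurableSpace Ω₀] {P₀ : Measure Ω₀} (hb : b ≠ 0)
    {W₀ : Ω₀ → ℝ} (hW₀ : ∀ᵐ ω ∂P₀, 0 ≤ W₀ ω) {W : CascadeVertex b → Ω → ℝ} (hind : iIndepFun W P)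
    (hlaw : ∀ v, IdentDistrib (W v) W₀ P P₀) {q : ℝ} (hq : 0 ≤ q) :
    ∃ V : CascadeVertex b → Ω → ℝ≥0∞,
      IsCascade P (P₀.map fun ω => ENNReal.ofReal (W₀ ω)) V ∧
        ∀ n, extMoment P (cascadeMass W n) q = ∫⁻ ω, extCascadeMass V n ω ^ q ∂P := by
  have hW v : AEMeasurable (W v) P := (hlaw v).aemeasurable_fst
  -- There are countably many vertices, so one null set serves all the weights.
  have hae : ∀ᵐ ω ∂P, ∀ v, W v ω = (hW v).mk (W v) ω := ae_all_iff.2 fun v => (hW v).ae_eq_mk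
  have hnn : ∀ᵐ ω ∂P, ∀ v, 0 ≤ W v ω :=
    ae_all_iff.2 fun v => (hlaw v).symm.ae_snd (measurableSet_Ici (a := (0 : ℝ))) hW₀
  refine ⟨fun v ω => ENNReal.ofReal ((hW v).mk (W v) ω), ⟨fun v => ?_, ?_, fun v => ?_⟩,
    fun n => ?_⟩
  · exact ENNReal.measurable_ofReal.comp (hW v).measurable_mk
  · exact (hind.congr fun v => (hW v).ae_eq_mk).comp _ fun _ => ENNReal.measurable_ofReal
  · refine Eq.trans ?_ ((hlaw v).comp ENNReal.measurable_ofReal).map_eq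
    exact Measure.map_congr ((hW v).ae_eq_mk.symm.fun_comp ENNReal.ofReal)
  · rw [extMoment_eq_lintegral _ hq]
    · refine lintegral_congr_ae ?_
      filter_upwards [hae, hnn] with ω h1 h2
      rw [ofReal_cascadeMass hb h2]
      simp only [extCascadeMass, h1]
    · filter_upwards [hnn] with ω h
      exact mul_nonneg (by positivity)
        (Finset.sum_nonneg fun j _ => Finset.prod_nonneg fun k _ => h _)

/-! ### Moment bounds uniform over cascades of a given law. -/

variable [IsProbabilityMeasure P]

theorem supMoment_zero_le (s : ℝ) : supMoment b P μ s 0 ≤ 1 :=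
  iSup₂_le fun V _ => by simp [extCascadeMass_zero]

theorem supMoment_le_two (hb : b ≠ 0) (hμ : ∫⁻ x, x ∂μ = 1) {s : ℝ} (hs : 0 ≤ s) (hs1 : s ≤ 1)
    (n : ℕ) : supMoment b P μ s n ≤ 2 := by
  refine iSup₂_le fun V h => ?_
  refine (lintegral_rpow_le_one_add P _ hs hs1).trans ?_
  simp [h.lintegral_extCascadeMass hb hμ, one_add_one_eq_two]

/-- Each subtree carries a cascade of the same law on the same space, so the supremum closes the
recursion without any identification of the laws of the masses. -/
theorem supMoment_succ_le (hb : b ≠ 0) (hμ : ∫⁻ x, x ∂μ = 1) {p : ℝ} (hp : 0 < p)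
    {a C K : ℝ≥0∞} (hC : ∀ y r : ℝ≥0∞, (y + r) ^ p ≤ a * y ^ p + C * r ^ p)
    (hK : ∀ n, supMoment b P μ p n ≤ K) (n : ℕ) :
    supMoment b P μ (1 + p) (n + 1) ≤
      a * ((∫⁻ x, x ^ (1 + p) ∂μ) / (b : ℝ≥0∞) ^ p) * supMoment b P μ (1 + p) n +
        C * (b : ℝ≥0∞) ^ p * (b * (b * ((∫⁻ x, x ^ p ∂μ) * K))) :=
  iSup₂_le fun _ h => h.lintegral_extCascadeMass_succ_rpow_le hb hμ hp hC n
    (fun i => ((h.subtree i).lintegral_rpow_le_supMoment p n).trans (hK n))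
    fun i => (h.subtree i).lintegral_rpow_le_supMoment (1 + p) n

theorem exists_supMoment_le [IsProbabilityMeasure μ] (hb : b ≠ 0) (hμ : ∫⁻ x, x ∂μ = 1) {p : ℝ}
    (hp : 0 < p) (hlt : ∫⁻ x, x ^ (1 + p) ∂μ < (b : ℝ≥0∞) ^ p) :
    ∃ K : ℝ≥0∞, K ≠ ∞ ∧ ∀ n, supMoment b P μ (1 + p) n ≤ K := by
  -- Induction on an integer bound for p: the statement at p - 1 controls the moments of order p.
  obtain ⟨N, hN⟩ := exists_nat_ge p
  induction N generalizing p with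
  | zero => exact absurd hN (by simpa using hp)
  | succ N ih =>
    obtain ⟨K, hK, hKb⟩ : ∃ K : ℝ≥0∞, K ≠ ∞ ∧ ∀ n, supMoment b P μ p n ≤ K := by
      rcases le_or_gt p 1 with hp1 | hp1
      · exact ⟨2, by simp, supMoment_le_two hb hμ hp.le hp1⟩
      · have := ih (p := p - 1) (by linarith)
          (lintegral_rpow_lt_of_lt hμ (by linarith) (by linarith) hlt)
          (by push_cast at hN; linarith)
        rwa [add_sub_cancel] at this
    set m := ∫⁻ x, x ^ (1 + p) ∂μ
    have hbp0 : (b : ℝ≥0∞) ^ p ≠ 0 := (zero_le.trans_lt hlt).ne'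
    have hbp : (b : ℝ≥0∞) ^ p ≠ ∞ := ENNReal.rpow_ne_top_of_nonneg hp.le (by simp)
    have hρ : m / (b : ℝ≥0∞) ^ p < 1 := by
      rwa [ENNReal.div_lt_iff (Or.inl hbp0) (Or.inl hbp), one_mul]
    -- The loss a > 1 on the diagonal is small enough to keep the recursion contracting.
    obtain ⟨a, ha1, ha⟩ := exists_between (ENNReal.one_lt_inv.2 hρ)
    have haρ : a * (m / (b : ℝ≥0∞) ^ p) < 1 := by
      rw [← one_div] at ha
      exact ENNReal.mul_lt_of_lt_div ha
    obtain ⟨C, hC, hCb⟩ := exists_add_rpow_le hp ha1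
    have hm' : ∫⁻ x, x ^ p ∂μ ≠ ∞ := by
      refine ne_top_of_le_ne_top ?_ (lintegral_rpow_le_one_add μ (fun x => x) hp.le
        (by linarith : p ≤ 1 + p))
      exact ENNReal.add_ne_top.2 ⟨by simp, hlt.ne_top⟩
    refine ⟨_, ?_, geometric_affine_bound (supMoment_zero_le _)
      (supMoment_succ_le hb hμ hp hCb hKb) haρ⟩
    have : (1 - a * (m / (b : ℝ≥0∞) ^ p)) ≠ 0 := (tsub_pos_of_lt haρ).ne'
    finiteness

theorem exists_supMoment_le_mul_pow [IsProbabilityMeasure μ] (hb : b ≠ 0) (hμ : ∫⁻ x, x ∂μ = 1)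
    {p : ℝ} (hp : 0 < p) (hp1 : p ≤ 1) (hlt : (b : ℝ≥0∞) ^ p < ∫⁻ x, x ^ (1 + p) ∂μ)
    (hm : ∫⁻ x, x ^ (1 + p) ∂μ ≠ ∞) :
    ∃ K : ℝ≥0∞, K ≠ 0 ∧ K ≠ ∞ ∧ ∀ n,
      supMoment b P μ (1 + p) n ≤ K * ((∫⁻ x, x ^ (1 + p) ∂μ) / (b : ℝ≥0∞) ^ p) ^ n := by
  set m := ∫⁻ x, x ^ (1 + p) ∂μ
  have hbp0 : (b : ℝ≥0∞) ^ p ≠ 0 := (ENNReal.rpow_pos (by simpa [pos_iff_ne_zero]) (by simp)).ne'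
  have hbp : (b : ℝ≥0∞) ^ p ≠ ∞ := ENNReal.rpow_ne_top_of_nonneg hp.le (by simp)
  have hρ : 1 < m / (b : ℝ≥0∞) ^ p := by
    rwa [ENNReal.lt_div_iff_mul_lt (Or.inl hbp0) (Or.inl hbp), one_mul]
  have hm' : ∫⁻ x, x ^ p ∂μ ≠ ∞ := by
    refine ne_top_of_le_ne_top ?_ (lintegral_rpow_le_one_add μ (fun x => x) hp.le hp1)
    simp [hμ]
  -- For p ≤ 1 the diagonal constant is exactly 1, so the recursion grows at the same rate as the
  -- lower bound.
  have hC (y r : ℝ≥0∞) : (y + r) ^ p ≤ 1 * y ^ p + 1 * r ^ p := by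
    simpa using ENNReal.rpow_add_le_add_rpow y r hp.le hp1
  set L := 1 * (b : ℝ≥0∞) ^ p * (b * (b * ((∫⁻ x, x ^ p ∂μ) * 2)))
  have hLtop : L ≠ ∞ := by finiteness
  have hρ0 : m / (b : ℝ≥0∞) ^ p - 1 ≠ 0 := (tsub_pos_of_lt hρ).ne'
  refine ⟨1 + L / (m / (b : ℝ≥0∞) ^ p - 1), (one_pos.trans_le le_self_add).ne',
    ENNReal.add_ne_top.2 ⟨by simp, ENNReal.div_ne_top hLtop hρ0⟩,
    geometric_affine_growth (supMoment_zero_le _) (fun n => ?_) hρ (ENNReal.div_ne_top hm hbp0)⟩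
  have := supMoment_succ_le hb hμ hp hC (supMoment_le_two hb hμ hp.le hp1) n (P := P)
  rwa [one_mul (m / (b : ℝ≥0∞) ^ p)] at this

end

theorem proposition3 {Ω₀ Ω : Type*} [MeasurableSpace Ω₀] [MeasurableSpace Ω]
    (P₀ : Measure Ω₀) [IsProbabilityMeasure P₀] (P : Measure Ω) [IsProbabilityMeasure P]
    (b : ℕ) (hb : 2 ≤ b)
    (W₀ : Ω₀ → ℝ) (hW₀_nonneg : ∀ᵐ ω ∂P₀, 0 ≤ W₀ ω) (hW₀_mean : ∫ ω, W₀ ω ∂P₀ = 1)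
    (W : CascadeVertex b → Ω → ℝ) (hW_indep : iIndepFun W P)
    (hW_law : ∀ v, IdentDistrib (W v) W₀ P P₀)
    (hTC : P₀.map W₀ ≠ totallyCriticalLaw b)
    (q : ℝ) (hq : 1 < q) :
    (extMoment P₀ W₀ q < (b : ℝ≥0∞) ^ (q - 1) →
      (⨆ n : ℕ, extMoment P (cascadeMass W n) q) < ∞) ∧
    ((b : ℝ≥0∞) ^ (q - 1) < extMoment P₀ W₀ q →
      ENNReal.log (extMoment P₀ W₀ q / (b : ℝ≥0∞) ^ (q - 1)) ≤
          liminf (fun n : ℕ => ENNReal.log (extMoment P (cascadeMass W n) q) / (n : EReal)) atTop ∧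
      (q ≤ 2 →
        Tendsto (fun n : ℕ => ENNReal.log (extMoment P (cascadeMass W n) q) / (n : EReal)) atTop
          (𝓝 (ENNReal.log (extMoment P₀ W₀ q / (b : ℝ≥0∞) ^ (q - 1)))))) := by
  have hb0 : b ≠ 0 := by omega
  obtain ⟨p, hp, rfl⟩ : ∃ p : ℝ, 0 < p ∧ q = 1 + p := ⟨q - 1, by linarith, by ring⟩
  -- The Bochner integral of a non-integrable function is 0, so mean one forces integrability.
  have hint : Integrable W₀ P₀ := .of_integral_ne_zero (by simp [hW₀_mean])
  have hmeas : AEMeasurable (fun ω => ENNReal.ofReal (W₀ ω)) P₀ := hint.aemeasurable.ennreal_ofReal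
  obtain ⟨V, hV, hVeq⟩ := exists_isCascade hb0 hW₀_nonneg hW_indep hW_law (by linarith : 0 ≤ 1 + p)
  have hmom : extMoment P₀ W₀ (1 + p) =
      ∫⁻ x, x ^ (1 + p) ∂(P₀.map fun ω => ENNReal.ofReal (W₀ ω)) := by
    rw [extMoment_eq_lintegral hW₀_nonneg (by linarith), lintegral_map' (by fun_prop) hmeas]
  have hmean : ∫⁻ x, x ∂(P₀.map fun ω => ENNReal.ofReal (W₀ ω)) = 1 := by
    rw [lintegral_map' (by fun_prop) hmeas, ← ofReal_integral_eq_lintegral_ofReal hint hW₀_nonneg,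
      hW₀_mean, ENNReal.ofReal_one]
  have : IsProbabilityMeasure (P₀.map fun ω => ENNReal.ofReal (W₀ ω)) :=
    Measure.isProbabilityMeasure_map hmeas
  simp only [hVeq, hmom, add_sub_cancel_left]
  set μ := P₀.map fun ω => ENNReal.ofReal (W₀ ω)
  have hlow := hV.pow_le_lintegral_extCascadeMass_rpow hb0 hp.le
  refine ⟨fun hlt => ?_, fun hlt => ⟨le_liminf_of_le (by isBoundedDefault)
    (eventually_log_le_log_div hlow), fun hq2 => ?_⟩⟩
  · obtain ⟨K, hK, hKb⟩ := exists_supMoment_le (P := P) hb0 hmean hp hlt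
    exact (iSup_le fun n => (hV.lintegral_rpow_le_supMoment _ n).trans (hKb n)).trans_lt
      hK.lt_top
  · by_cases hm : ∫⁻ x, x ^ (1 + p) ∂μ = ∞
    -- With an infinite moment, the lower bound alone makes the sequence eventually +∞.
    · have htop : (∫⁻ x, x ^ (1 + p) ∂μ) / (b : ℝ≥0∞) ^ p = ∞ := by
        rw [hm, ENNReal.top_div_of_ne_top (ENNReal.rpow_ne_top_of_nonneg hp.le (by simp))]
      have hev := eventually_log_le_log_div hlow
      rw [htop, ENNReal.log_top] at hev ⊢
      exact tendsto_const_nhds.congr' (hev.mono fun n hn => (top_le_iff.1 hn).symm)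
    · obtain ⟨K, hK, hK', hKb⟩ :=
        exists_supMoment_le_mul_pow (P := P) hb0 hmean hp (by linarith) hlt hm
      exact tendsto_log_div hK hK' hlow
        fun n => (hV.lintegral_rpow_le_supMoment _ n).trans (hKb n)
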